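/- Let $G$ be a finite simple graph with vertices $v_1,\dots,v_n$, let $Q(G)=A(G)+D(G)$ be its signless Laplacian (adjacency matrix plus diagonal degree matrix), and let $a_0$ be the constant term of the characteristic polynomial $\det(tI-Q(G))$. For a graph $H$ whose $N$ vertices are listed in some order, let $W_Q(H)=[e,\,Q(H)e,\,\dots,\,Q(H)^{N-1}e]$ be its $Q$-walk matrix, where $e$ is the all-ones vector and the rows are in the given order of the vertices. For $k\ge 1$ let $G\circ P_k$ be the rooted product of $G$ with the path $p_1p_2\cdots p_k$ rooted at $p_1$: its vertices are the pairs $(v_i,p_s)$ with $1\le i\le n$, $1\le s\le k$, and its edges are $(v_i,p_1)\sim(v_j,p_1)$ for $v_iv_j\in E(G)$ and $(v_i,p_s)\sim(v_i,p_{s+1})$ for $1\le i\le n$, $1\le s\le k-1$. Then for every $k\ge1$, with the vertices of $G\circ P_k$ listed in the block order $(v_1,p_1),\dots,(v_n,p_1),(v_1,p_2),\dots,(v_n,p_2),\dots,(v_1,p_k),\dots,(v_n,p_k)$, $$\det W_Q(G\circ P_k)=(-1)^{\frac{nk(k+1)}{2}+n}\,a_0^{\,k-1}\,\bigl(\det W_Q(G)\bigr)^k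 .$$ Consequently, for any order of the vertices of $G\circ P_k$, $\det W_Q(G\circ P_k)=\pm a_0^{\,k-1}\bigl(\det W_Q(G)\bigr)^k$. -/

import Mathlib

/-- The signless Laplacian `Q(G) = D(G) + A(G)` of a finite simple graph, an integer matrix. -/
def signlessLaplacian {V : Type*} [Fintype V] [DecidableEq V] (G : SimpleGraph V)
    [DecidableRel G.Adj] : Matrix V V ℤ :=
  G.degMatrix ℤ + G.adjMatrix ℤ

/-- The `Q`-walk matrix `W_Q(G) = [e, Q e, …, Q ^ (N - 1) e]`, where `e` is the all-ones vector
and the `N` vertices of `G` are listed in the order `σ`: row `r` belongs to the vertex at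
position `r`, and column `j` is `Q ^ j e`. -/
def qWalkMatrix {V : Type*} [Fintype V] [DecidableEq V] (G : SimpleGraph V)
    [DecidableRel G.Adj] {N : ℕ} (σ : V ≃ Fin N) : Matrix (Fin N) (Fin N) ℤ :=
  Matrix.of fun r j => Matrix.mulVec (signlessLaplacian G ^ (j : ℕ)) (fun _ => 1) (σ.symm r)

/-- The rooted product of `G` with the graph `H` rooted at `w`: one copy of `H` for every vertex
of `G`, and the roots of the copies joined as in `G`. -/
def rootedProduct {V W : Type*} (G : SimpleGraph V) (H : SimpleGraph W) (w : W) :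
    SimpleGraph (V × W) where
  Adj x y := (G.Adj x.1 y.1 ∧ x.2 = w ∧ y.2 = w) ∨ (x.1 = y.1 ∧ H.Adj x.2 y.2)
  symm := ⟨by
    rintro x y (⟨h, hx, hy⟩ | ⟨h, h'⟩)
    · exact Or.inl ⟨h.symm, hy, hx⟩
    · exact Or.inr ⟨h.symm, h'.symm⟩⟩
  loopless := ⟨by
    rintro x (⟨h, -, -⟩ | ⟨-, h⟩)
    · exact G.loopless.irrefl _ h
    · exact H.loopless.irrefl _ h⟩

/-- `G ∘ P_k`: the rooted product of `G` with the path `P_k` on the vertices `0, …, k - 1`,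
rooted at its end vertex `0`. -/
def rootedPathProduct {V : Type*} (G : SimpleGraph V) (k : ℕ) (hk : 1 ≤ k) :
    SimpleGraph (V × Fin k) :=
  rootedProduct G (SimpleGraph.pathGraph k) ⟨0, hk⟩

/-- The explicit edges of `G ∘ P_k`. -/
theorem rootedPathProduct_adj {V : Type*} (G : SimpleGraph V) (k : ℕ) (hk : 1 ≤ k)
    (x y : V × Fin k) :
    (rootedPathProduct G k hk).Adj x y ↔
      (G.Adj x.1 y.1 ∧ (x.2 : ℕ) = 0 ∧ (y.2 : ℕ) = 0) ∨
        (x.1 = y.1 ∧ ((x.2 : ℕ) + 1 = y.2 ∨ (y.2 : ℕ) + 1 = x.2)) := by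
  simp [rootedPathProduct, rootedProduct, SimpleGraph.pathGraph_adj, Fin.ext_iff]

instance rootedPathProduct.decidableAdj {V : Type*} [DecidableEq V] (G : SimpleGraph V) [DecidableRel G.Adj] (k : ℕ)
    (hk : 1 ≤ k) : DecidableRel (rootedPathProduct G k hk).Adj := fun x y =>
  decidable_of_iff _ (rootedPathProduct_adj G k hk x y).symm

/-- The block ordering of the vertices of `G ∘ P_k`: first all `(v, 0)`, then all `(v, 1)`, and
so on, each block being listed in the given order `σ` of the vertices of `G`. -/
def blockOrder {V : Type*} {n : ℕ} (σ : V ≃ Fin n) (k : ℕ) : V × Fin k ≃ Fin (k * n) :=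
  ((Equiv.prodComm V (Fin k)).trans (Equiv.prodCongr (Equiv.refl (Fin k)) σ)).trans
    finProdFinEquiv

/-- The position of `(v, s)` in the block ordering. -/
theorem blockOrder_val {V : Type*} {n : ℕ} (σ : V ≃ Fin n) (k : ℕ) (v : V) (s : Fin k) :
    (blockOrder σ k (v, s) : ℕ) = (σ v : ℕ) + n * (s : ℕ) := by
  simp [blockOrder]

/-! Over ℝ, `Q(G)` has an orthonormal eigenbasis `U` with eigenvalues `d i`; write `e = U c`. Then
`W_Q(G)` is `U diag(c)` times the Vandermonde matrix of `d`. On the `i`-th eigenvector tensored with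
the path, `Q(G ∘ P_k)` acts as `pathMatrix κ (d i)` with `κ = k - 1`, the path being read backwards
so that the root comes last. Hence `W_Q(G ∘ P_k)` is, up to row and column permutations, `(U
diag(c)) ⊗ 1` times the walk matrix of the direct sum of these path matrices.

That last determinant (`det_sum_pathMatrix_walk`) is found by replacing monomials by a Newton-type
basis. By `pathSeq_top`, `pathAnnihilator κ x` takes the value `(y - x) q_κ` at `pathMatrix κ y`, so
the matrix becomes block triangular. Its diagonal blocks need only `det q_κ`, the sign of the
reversal (`det_pathSeq_top`), and the walk determinant `x ^ κ` of one path (`det_pathMatrix_walk`).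
The eigenvalue differences form a power of the Vandermonde determinant, and the product of the `d i`
is `det Q(G) = (-1)^n a₀`. -/

namespace QWalk

open Polynomial Matrix

/-! ### The polynomials `q_j` and their partial sums -/

section PathSeq

variable {A B : Type*} [Ring A] [Ring B]

/-- The sequence `1, t - 1, …` with `q (j + 2) = (t - 2) q (j + 1) - q j`. Applied to the signless
Laplacian of a path, `q j` maps the basis vector of an end vertex to the `j`-th basis vector. -/
def pathSeq (t : A) : ℕ → A
  | 0 => 1
  | 1 => t - 1
  | j + 2 => (t - 2) * pathSeq t (j + 1) - pathSeq t j

/-- The sum of the first `n` terms of `pathSeq`. -/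
def pathSum (t : A) (n : ℕ) : A := ∑ j ∈ Finset.range n, pathSeq t j

theorem pathSeq_zero (t : A) : pathSeq t 0 = 1 := rfl

theorem pathSeq_one (t : A) : pathSeq t 1 = t - 1 := rfl

theorem pathSeq_add_two (t : A) (j : ℕ) :
    pathSeq t (j + 2) = (t - 2) * pathSeq t (j + 1) - pathSeq t j := rfl

theorem map_pathSeq {F : Type*} [FunLike F A B] [RingHomClass F A B] (f : F) (t : A) (j : ℕ) :
    f (pathSeq t j) = pathSeq (f t) j := by
  induction j using Nat.twoStepInduction with
  | zero => simp [pathSeq_zero]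
  | one => simp [pathSeq_one]
  | more j h₁ h₂ => simp [pathSeq_add_two, h₁, h₂, map_ofNat f 2]

theorem map_pathSum {F : Type*} [FunLike F A B] [RingHomClass F A B] (f : F) (t : A) (n : ℕ) :
    f (pathSum t n) = pathSum (f t) n := by
  simp [pathSum, map_pathSeq]

theorem commute_pathSeq {a t : A} (h : Commute a t) (j : ℕ) : Commute a (pathSeq t j) := by
  induction j using Nat.twoStepInduction with
  | zero => exact Commute.one_right a
  | one => exact h.sub_right (Commute.one_right a)
  | more j h₁ h₂ =>
    exact ((h.sub_right (Commute.ofNat_right a 2)).mul_right h₂).sub_right h₁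

end PathSeq

theorem sub_four_mul_pathSum {A : Type*} [CommRing A] (t : A) (n : ℕ) :
    (t - 4) * pathSum t (n + 1) = pathSeq t (n + 1) - pathSeq t n - 2 := by
  induction n with
  | zero => simp [pathSum, pathSeq_one, pathSeq_zero]; ring
  | succ n ih =>
    rw [pathSum, Finset.sum_range_succ, ← pathSum, mul_add, ih, pathSeq_add_two]
    ring

/-- At a path matrix the right side becomes `(x q_κ)²` by `pathSeq_top`, so this identity forces the
determinant of the sum to divide a power of `x`. -/
theorem pathSum_mul {A : Type*} [CommRing A] (t : A) (n : ℕ) :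
    pathSum t (n + 1) * (t * ((t - 4) * pathSum t (n + 1) + 4)) =
      (pathSeq t (n + 1) + pathSeq t n) ^ 2 := by
  induction n with
  | zero => simp [pathSum, pathSeq_one, pathSeq_zero]; ring
  | succ n ih =>
    have h := sub_four_mul_pathSum t n
    have hs : pathSum t (n + 1 + 1) = pathSum t (n + 1) + pathSeq t (n + 1) :=
      Finset.sum_range_succ _ _
    rw [hs, pathSeq_add_two]
    linear_combination ih + 2 * t * pathSeq t (n + 1) * h

theorem monic_natDegree_pathSeq {R : Type*} [CommRing R] [Nontrivial R] (j : ℕ) :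
    (pathSeq (X : R[X]) j).Monic ∧ (pathSeq (X : R[X]) j).natDegree = j := by
  induction j using Nat.twoStepInduction with
  | zero => simp [pathSeq_zero]
  | one => exact ⟨monic_X_sub_C 1, natDegree_X_sub_C 1⟩
  | more j h₁ h₂ =>
    have h2 : (X - 2 : R[X]).Monic := monic_X_sub_C 2
    have hm : ((X - 2 : R[X]) * pathSeq X (j + 1)).Monic := h2.mul h₂.1
    have hd : ((X - 2 : R[X]) * pathSeq X (j + 1)).natDegree = j + 2 := by
      rw [h2.natDegree_mul h₂.1, h₂.2, show (X - 2 : R[X]) = X - C 2 from rfl, natDegree_X_sub_C]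
      ring
    have hlt : (pathSeq (X : R[X]) j).degree < ((X - 2 : R[X]) * pathSeq X (j + 1)).degree := by
      apply degree_lt_degree
      rw [hd, h₁.2]
      omega
    rw [pathSeq_add_two]
    exact ⟨hm.sub_of_left hlt, by rw [natDegree_sub_eq_left_of_natDegree_lt]
                                  · exact hd
                                  · rw [hd, h₁.2]; omega⟩

/-- Replacing the monomials by monic polynomials of the same degrees does not change a
determinant whose rows are linear functionals on polynomials. -/
theorem det_linearMap_monic {R : Type*} [CommRing R] {N : ℕ} (φ : Fin N → R[X] →ₗ[R] R)
    (p : Fin N → R[X]) (hd : ∀ j, (p j).natDegree = j) (hp : ∀ j, (p j).Monic) :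
    (Matrix.of fun r j : Fin N => φ r (X ^ (j : ℕ))).det =
      (Matrix.of fun r j : Fin N => φ r (p j)).det := by
  have h : (Matrix.of fun r j : Fin N => φ r (p j)) =
      (Matrix.of fun r j : Fin N => φ r (X ^ (j : ℕ))) *
        Matrix.of fun i j : Fin N => (p j).coeff i := by
    ext r j
    conv_lhs => rw [of_apply, (p j).as_sum_range' N (by rw [hd]; exact j.2)]
    rw [map_sum, mul_apply, ← Fin.sum_univ_eq_sum_range
      (fun i => φ r (monomial i ((p j).coeff i)))]
    refine Finset.sum_congr rfl fun i _ => ?_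
    rw [← C_mul_X_pow_eq_monomial, ← smul_eq_C_mul, map_smul, smul_eq_mul, mul_comm]
    rfl
  rw [h, det_mul, det_matrixOfPolynomials p hd hp, mul_one]

/-! ### The path matrix and its commutant -/

section PathMatrix

variable {R S : Type*} [CommRing R] [CommRing S]

/-- The signless Laplacian of the path on `0, …, κ`, with `x` added to the last diagonal entry. -/
def pathMatrix (κ : ℕ) (x : R) : Matrix (Fin (κ + 1)) (Fin (κ + 1)) R :=
  Matrix.of fun i j =>
    (if 0 < (i : ℕ) then (if (j : ℕ) = i - 1 then 1 else 0) + (if (j : ℕ) = i then 1 else 0)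
      else 0) +
    (if (i : ℕ) < κ then (if (j : ℕ) = i then 1 else 0) + (if (j : ℕ) = i + 1 then 1 else 0)
      else if (j : ℕ) = i then x else 0)

theorem pathMatrix_mulVec (κ : ℕ) (x : R) (f : ℕ → R) (i : Fin (κ + 1)) :
    (pathMatrix κ x *ᵥ fun j => f j) i =
      (if 0 < (i : ℕ) then f (i - 1) + f i else 0) +
        (if (i : ℕ) < κ then f i + f (i + 1) else x * f i) := by
  have hi := i.2
  simp only [mulVec, dotProduct, pathMatrix, of_apply]
  rw [Fin.sum_univ_eq_sum_range (fun j =>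
    ((if 0 < (i : ℕ) then (if j = i - 1 then (1 : R) else 0) + (if j = i then 1 else 0) else 0) +
    (if (i : ℕ) < κ then (if j = i then 1 else 0) + (if j = i + 1 then 1 else 0)
      else if j = i then x else 0)) * f j)]
  split_ifs <;> simp [add_mul, Finset.sum_add_distrib] <;> grind

theorem pathMatrix_map (κ : ℕ) (x : R) (f : R →+* S) :
    (pathMatrix κ x).map f = pathMatrix κ (f x) := by
  ext i j
  simp only [pathMatrix, of_apply, map_apply]
  split_ifs <;> simp

/-- The `j`-th basis vector. -/
def pathBasis (R : Type*) [CommRing R] (κ j : ℕ) : Fin (κ + 1) → R :=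
  fun i => if (i : ℕ) = j then 1 else 0

theorem pathMatrix_mulVec_pathBasis (κ : ℕ) (x : R) (j : ℕ) (i : Fin (κ + 1)) :
    (pathMatrix κ x *ᵥ pathBasis R κ j) i =
      (if 0 < (i : ℕ) then (if (i : ℕ) - 1 = j then 1 else 0) + (if (i : ℕ) = j then 1 else 0)
        else 0) +
      (if (i : ℕ) < κ then (if (i : ℕ) = j then 1 else 0) + (if (i : ℕ) + 1 = j then 1 else 0)
        else x * if (i : ℕ) = j then 1 else 0) :=
  pathMatrix_mulVec κ x (fun i => if i = j then 1 else 0) i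

theorem pathSeq_mulVec_zero (κ : ℕ) (x : R) (j : ℕ) (hj : j ≤ κ) :
    pathSeq (pathMatrix κ x) j *ᵥ pathBasis R κ 0 = pathBasis R κ j := by
  induction j using Nat.twoStepInduction with
  | zero => simp [pathSeq_zero]
  | one =>
    rw [pathSeq_one, sub_mulVec, one_mulVec]
    ext i
    rw [Pi.sub_apply, pathMatrix_mulVec_pathBasis]
    simp only [pathBasis]
    grind
  | more j h₁ h₂ =>
    rw [pathSeq_add_two, sub_mulVec, ← mulVec_mulVec, h₂ (by omega), h₁ (by omega), sub_mulVec]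
    ext i
    have := i.2
    simp only [Pi.sub_apply, ofNat_mulVec, Pi.smul_apply, pathMatrix_mulVec_pathBasis]
    simp only [pathBasis, ofNat_smul_eq_nsmul, nsmul_eq_mul, Nat.cast_ofNat]
    grind

/-- A matrix commuting with `pathMatrix` is determined by its first column. -/
theorem eq_of_commute_pathMatrix (κ : ℕ) (x : R) {M N : Matrix (Fin (κ + 1)) (Fin (κ + 1)) R}
    (hM : Commute M (pathMatrix κ x)) (hN : Commute N (pathMatrix κ x))
    (h : M *ᵥ pathBasis R κ 0 = N *ᵥ pathBasis R κ 0) : M = N := by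
  apply Matrix.ext_of_mulVec_single
  intro j
  have hj : Pi.single j 1 = pathBasis R κ j := by
    ext i
    simp [pathBasis, Pi.single_apply, Fin.ext_iff]
  -- Column `j` is `M q_j e_0 = q_j M e_0`.
  rw [hj, ← pathSeq_mulVec_zero κ x j (by omega), mulVec_mulVec, mulVec_mulVec,
    (commute_pathSeq hM j).eq, (commute_pathSeq hN j).eq, ← mulVec_mulVec, ← mulVec_mulVec, h]

theorem commute_pathSeq_self (κ : ℕ) (x : R) (j : ℕ) :
    Commute (pathSeq (pathMatrix κ x) j) (pathMatrix κ x) :=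
  (commute_pathSeq (Commute.refl _) j).symm

/-- Both sides commute with the path matrix, so it suffices to compare them on `e_0`. There the
recursion meets the last diagonal entry, `1 + x` when `κ > 0`, and both give `x e_κ`. -/
theorem pathSeq_top (κ : ℕ) (x : R) :
    pathSeq (pathMatrix κ x) (κ + 1) + pathSeq (pathMatrix κ x) κ =
      x • pathSeq (pathMatrix κ x) κ := by
  refine eq_of_commute_pathMatrix κ x
    ((commute_pathSeq_self κ x _).add_left (commute_pathSeq_self κ x _))
    ((commute_pathSeq_self κ x _).smul_left x) ?_
  rw [add_mulVec, smul_mulVec, pathSeq_mulVec_zero κ x κ le_rfl]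
  ext i
  have hi := i.2
  obtain _ | κ := κ
  · change (((pathMatrix 0 x - 1) *ᵥ _ + _ : _ → R)) i = _
    rw [sub_mulVec, one_mulVec]
    simp only [Pi.add_apply, Pi.sub_apply, Pi.smul_apply, pathMatrix_mulVec_pathBasis]
    simp only [pathBasis, smul_eq_mul]
    grind
  · rw [pathSeq_add_two, sub_mulVec, ← mulVec_mulVec, pathSeq_mulVec_zero _ x _ le_rfl,
      pathSeq_mulVec_zero _ x κ (by omega), sub_mulVec]
    simp only [Pi.add_apply, Pi.sub_apply, Pi.smul_apply, ofNat_mulVec,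
      pathMatrix_mulVec_pathBasis]
    simp only [pathBasis, smul_eq_mul]
    grind

end PathMatrix

/-! ### Determinants attached to a single path -/

section PathDet

variable {R : Type*} [CommRing R]

/-- Each step moves the front of `e_κ` one place towards `0` with coefficient `1`; entries behind
the front, where `x` matters, are left unspecified. -/
theorem pathSeq_mulVec_last (κ : ℕ) (x : R) (j : ℕ) (i : Fin (κ + 1)) (hij : (i : ℕ) + j ≤ κ) :
    (pathSeq (pathMatrix κ x) j *ᵥ pathBasis R κ κ) i = if (i : ℕ) + j = κ then 1 else 0 := by
  induction j using Nat.twoStepInduction generalizing i with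
  | zero => simp [pathSeq_zero, pathBasis]
  | one =>
    rw [pathSeq_one, sub_mulVec, one_mulVec, Pi.sub_apply, pathMatrix_mulVec_pathBasis]
    simp only [pathBasis]
    grind
  | more j h₁ h₂ =>
    rw [pathSeq_add_two, sub_mulVec, ← mulVec_mulVec, sub_mulVec]
    simp only [Pi.sub_apply, ofNat_mulVec, Pi.smul_apply]
    rw [h₁ i (by omega), h₂ i (by omega)]
    generalize pathSeq (pathMatrix κ x) (j + 1) *ᵥ pathBasis R κ κ = v at h₂
    let f : ℕ → R := fun m => if h : m < κ + 1 then v ⟨m, h⟩ else 0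
    have hv : v = fun m : Fin (κ + 1) => f m := by
      ext m
      simp only [f, m.2, dif_pos]
    have hf : ∀ m, m + (j + 1) ≤ κ → f m = if m + (j + 1) = κ then 1 else 0 := by
      intro m hm
      have h := h₂ ⟨m, by omega⟩ hm
      simpa [hv] using h
    have h0 : f i = 0 := by rw [hf i (by omega), if_neg (by omega)]
    have hp : f (i - 1) = 0 := by rw [hf _ (by omega), if_neg (by omega)]
    have hs : f (i + 1) = if (i : ℕ) + (j + 2) = κ then 1 else 0 := by
      rw [hf _ (by omega)]
      congr 1
      simp only [eq_iff_iff]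
      omega
    rw [hv, pathMatrix_mulVec, if_pos (show (i : ℕ) < κ by omega), h0, hp, hs,
      if_neg (show (i : ℕ) + (j + 1) ≠ κ by omega), if_neg (show (i : ℕ) + j ≠ κ by omega)]
    simp

theorem mulVec_pathBasis_apply (κ : ℕ) (M : Matrix (Fin (κ + 1)) (Fin (κ + 1)) R)
    (i j : Fin (κ + 1)) : (M *ᵥ pathBasis R κ j) i = M i j := by
  have hj : pathBasis R κ j = Pi.single j 1 := by
    ext i
    simp [pathBasis, Pi.single_apply, Fin.ext_iff]
  rw [hj, mulVec_single_one, col_apply]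

/-- The columns of a matrix commuting with `pathMatrix`. -/
theorem apply_of_commute_pathMatrix (κ : ℕ) (x : R) {M : Matrix (Fin (κ + 1)) (Fin (κ + 1)) R}
    (hM : Commute M (pathMatrix κ x)) (i j : Fin (κ + 1)) :
    M i j = (pathSeq (pathMatrix κ x) j *ᵥ (M *ᵥ pathBasis R κ 0)) i := by
  rw [mulVec_mulVec, ← (commute_pathSeq hM j).eq, ← mulVec_mulVec,
    pathSeq_mulVec_zero κ x j (by omega), mulVec_pathBasis_apply]

theorem det_pathSeq_top (κ : ℕ) (x : R) :
    (pathSeq (pathMatrix κ x) κ).det = ((Equiv.Perm.sign (Fin.revPerm : Equiv.Perm (Fin (κ + 1))) : ℤ) : R) := by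
  set M := pathSeq (pathMatrix κ x) κ with hM
  have hentry : ∀ i j : Fin (κ + 1), (i : ℕ) + j ≤ κ → M i j = if (i : ℕ) + j = κ then 1 else 0 := by
    intro i j hij
    rw [hM, apply_of_commute_pathMatrix κ x (commute_pathSeq_self κ x κ) i j,
      pathSeq_mulVec_zero κ x κ le_rfl, pathSeq_mulVec_last κ x j i hij]
  -- `M` vanishes above its antidiagonal, which consists of ones; reversing the rows makes it upper
  -- unitriangular.
  have htri : (M.submatrix (Fin.revPerm : Equiv.Perm (Fin (κ + 1))) id).det = 1 := by
    rw [det_of_isUpperTriangular]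
    · refine Finset.prod_eq_one fun i _ => ?_
      rw [submatrix_apply, hentry _ _ (by simp [Fin.val_rev]; omega), if_pos]
      simp [Fin.val_rev]
      omega
    · intro i j hij
      have hij' : (j : ℕ) < i := hij
      rw [submatrix_apply, hentry _ _ (by simp [Fin.val_rev]; omega), if_neg]
      simp [Fin.val_rev]
      omega
  rw [det_permute] at htri
  have h1 : ((Equiv.Perm.sign (Fin.revPerm : Equiv.Perm (Fin (κ + 1))) : ℤ) : R) *
      ((Equiv.Perm.sign (Fin.revPerm : Equiv.Perm (Fin (κ + 1))) : ℤ) : R) = 1 := by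
    rw [← Int.cast_mul, ← Units.val_mul, Int.units_mul_self]
    simp
  linear_combination ((Equiv.Perm.sign (Fin.revPerm : Equiv.Perm (Fin (κ + 1))) : ℤ) : R) * htri -
    M.det * h1

theorem pathSum_mulVec_zero (κ : ℕ) (x : R) :
    pathSum (pathMatrix κ x) (κ + 1) *ᵥ pathBasis R κ 0 = fun _ => 1 := by
  have h : ∀ j ∈ Finset.range (κ + 1),
      pathSeq (pathMatrix κ x) j *ᵥ pathBasis R κ 0 = pathBasis R κ j := fun j hj =>
    pathSeq_mulVec_zero κ x j (by simpa [Nat.lt_succ_iff] using hj)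
  rw [pathSum, sum_mulVec, Finset.sum_congr rfl h]
  ext i
  rw [Finset.sum_apply]
  simp only [pathBasis, Finset.sum_ite_eq, Finset.mem_range, i.2, if_true]

theorem commute_pathSum_self (κ : ℕ) (x : R) (n : ℕ) :
    Commute (pathSum (pathMatrix κ x) n) (pathMatrix κ x) :=
  Commute.sum_left _ _ _ fun j _ => commute_pathSeq_self κ x j

/-- The sum commutes with the path matrix and sends `e_0` to `e`, so it is the walk matrix with the
monomials replaced by the `q_j`. -/
theorem pathSum_apply (κ : ℕ) (x : R) (i j : Fin (κ + 1)) :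
    pathSum (pathMatrix κ x) (κ + 1) i j = (pathSeq (pathMatrix κ x) j *ᵥ fun _ => 1) i := by
  rw [apply_of_commute_pathMatrix κ x (commute_pathSum_self κ x _) i j, pathSum_mulVec_zero]

theorem pathSeq_two_mulVec_one (κ j : ℕ) (hj : j ≤ κ) :
    (pathSeq (pathMatrix κ (2 : ℤ)) j *ᵥ fun _ => 1) =
      fun i : Fin (κ + 1) => 1 + 2 * ((min (i : ℕ) j : ℕ) : ℤ) := by
  induction j using Nat.twoStepInduction with
  | zero => simp [pathSeq_zero]
  | one =>
    ext i
    have hi := i.2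
    rw [pathSeq_one, sub_mulVec, one_mulVec, Pi.sub_apply,
      pathMatrix_mulVec κ (2 : ℤ) (fun _ => 1) i]
    grind
  | more j h₁ h₂ =>
    ext i
    have hi := i.2
    rw [pathSeq_add_two, sub_mulVec, ← mulVec_mulVec, h₂ (by omega), h₁ (by omega), sub_mulVec]
    simp only [Pi.sub_apply, ofNat_mulVec, Pi.smul_apply]
    rw [pathMatrix_mulVec κ (2 : ℤ) (fun i => 1 + 2 * ((min i (j + 1) : ℕ) : ℤ)) i]
    simp only [ofNat_smul_eq_nsmul, nsmul_eq_mul, Nat.cast_ofNat]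
    split_ifs <;> omega

theorem det_one_add_two_min (κ : ℕ) :
    (Matrix.of fun i j : Fin (κ + 1) => (1 + 2 * ((min (i : ℕ) j : ℕ) : ℤ))).det = 2 ^ κ := by
  let L : Matrix (Fin (κ + 1)) (Fin (κ + 1)) ℤ := Matrix.of fun i l => if l ≤ i then 1 else 0
  let d : ℕ → ℤ := fun l => if l = 0 then 1 else 2
  have hL : L.det = 1 := by
    rw [det_of_isLowerTriangular]
    · simp [L]
    · intro i j hij
      have hij' : i < j := hij
      simp [L, hij']
  -- `1 + 2 min(i, j)` is the sum of the weights `1, 2, 2, …` over all `l ≤ min(i, j)`.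
  have h : (Matrix.of fun i j : Fin (κ + 1) => (1 + 2 * ((min (i : ℕ) j : ℕ) : ℤ))) =
      L * diagonal (fun l : Fin (κ + 1) => d l) * Lᵀ := by
    ext i j
    rw [mul_apply]
    simp only [mul_diagonal, transpose_apply, of_apply, L, Fin.le_def]
    rw [Fin.sum_univ_eq_sum_range
      (fun l => (if l ≤ (i : ℕ) then (1 : ℤ) else 0) * d l * if l ≤ (j : ℕ) then 1 else 0)]
    have hsub : Finset.range (min (i : ℕ) j + 1) ⊆ Finset.range (κ + 1) := by
      intro l
      simp
      omega
    rw [← Finset.sum_subset hsub]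
    · rw [Finset.sum_range_succ', Finset.sum_congr rfl (g := fun _ => (2 : ℤ))]
      · simp [d]
        ring
      · intro l hl
        have := Finset.mem_range.1 hl
        rw [if_pos (by omega), if_pos (by omega)]
        simp [d]
    · intro l _ hl
      simp only [Finset.mem_range] at hl
      grind
  rw [h, det_mul, det_mul, det_transpose, hL, det_diagonal,
    Fin.prod_univ_succ]
  simp [d]

theorem det_pathSum_two (κ : ℕ) : (pathSum (pathMatrix κ (2 : ℤ)) (κ + 1)).det = 2 ^ κ := by
  rw [← det_one_add_two_min κ]
  congr 1
  ext i j
  rw [pathSum_apply, pathSeq_two_mulVec_one κ j (by omega), of_apply]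

theorem det_pathSum_map {S : Type*} [CommRing S] (κ n : ℕ) (x : R) (f : R →+* S) :
    f (pathSum (pathMatrix κ x) n).det = (pathSum (pathMatrix κ (f x)) n).det := by
  rw [RingHom.map_det, map_pathSum (f.mapMatrix (m := Fin (κ + 1))), RingHom.mapMatrix_apply, pathMatrix_map]

theorem det_pathSum_dvd (κ : ℕ) (x : R) :
    (pathSum (pathMatrix κ x) (κ + 1)).det ∣ x ^ (2 * (κ + 1)) := by
  have h := congrArg (aeval (pathMatrix κ x)) (pathSum_mul (X : R[X]) κ)
  rw [map_mul, map_pow, map_add, map_pathSum, map_pathSeq, map_pathSeq, aeval_X, pathSeq_top] at h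
  have h' := congrArg Matrix.det h
  rw [det_mul, det_pow, det_smul, det_pathSeq_top, mul_pow, ← Int.cast_pow, ← Units.val_pow_eq_pow_val,
    Int.units_sq] at h'
  simp only [Fintype.card_fin, Units.val_one, Int.cast_one, mul_one] at h'
  rw [mul_comm 2, pow_mul, ← h']
  exact Dvd.intro _ rfl

/-- At `t = pathMatrix κ x`, the sum of the `pathSeq` has determinant `x ^ κ`. -/
theorem det_pathSum (κ : ℕ) (x : R) : (pathSum (pathMatrix κ x) (κ + 1)).det = x ^ κ := by
  suffices h : (pathSum (pathMatrix κ (X : ℤ[X])) (κ + 1)).det = X ^ κ by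
    have := congrArg (aeval x : ℤ[X] →ₐ[ℤ] R).toRingHom h
    rw [det_pathSum_map] at this
    simpa using this
  -- A divisor of a power of the prime `X` in `ℤ[X]` is `± X ^ M`; the value `2 ^ κ` at `X = 2`
  -- fixes both the sign and `M`.
  obtain ⟨M, -, hM⟩ := (dvd_prime_pow prime_X _).1 (det_pathSum_dvd κ (X : ℤ[X]))
  obtain ⟨u, hu⟩ := hM.symm
  obtain ⟨r, hr, hru⟩ := Polynomial.isUnit_iff.1 u.isUnit
  rw [← hru] at hu
  have h2 := congrArg (evalRingHom 2) hu
  rw [det_pathSum_map] at h2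
  simp only [coe_evalRingHom, eval_mul, eval_pow, eval_X, eval_C, det_pathSum_two] at h2
  have hr1 : r = 1 := by
    rcases Int.isUnit_iff.1 hr with h | h
    · exact h
    · have : (0 : ℤ) < 2 ^ M := by positivity
      have : (0 : ℤ) < 2 ^ κ := by positivity
      subst h
      omega
  subst hr1
  rw [mul_one] at h2
  have hMκ : M = κ := Nat.pow_right_injective le_rfl (by exact_mod_cast h2)
  rw [← hu, hMκ, C_1, mul_one]

/-- The walk matrix of `pathMatrix κ x`. -/
theorem det_pathMatrix_walk (κ : ℕ) (x : R) :
    (Matrix.of fun i j : Fin (κ + 1) => (pathMatrix κ x ^ (j : ℕ) *ᵥ fun _ => 1) i).det =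
      x ^ κ := by
  nontriviality R
  let φ : Fin (κ + 1) → R[X] →ₗ[R] R := fun i =>
    (LinearMap.proj i ∘ₗ (mulVecBilin R R).flip (fun _ => 1)) ∘ₗ (aeval (pathMatrix κ x)).toLinearMap
  have hφ : ∀ i p, φ i p = (aeval (pathMatrix κ x) p *ᵥ fun _ => 1) i := fun _ _ => rfl
  have h := det_linearMap_monic φ (fun j => pathSeq X j) (fun j => (monic_natDegree_pathSeq _).2)
    (fun j => (monic_natDegree_pathSeq _).1)
  simp only [hφ, map_pow, map_pathSeq, aeval_X] at h
  rw [h, ← det_pathSum κ x]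
  congr 1
  ext i j
  rw [pathSum_apply, of_apply]

end PathDet

/-! ### Direct sums of path matrices via a Newton basis -/

section Newton

variable {R : Type*} [CommRing R]

/-- A monic polynomial of degree `κ + 1` which annihilates `pathMatrix κ x`. -/
noncomputable def pathAnnihilator (κ : ℕ) (x : R) : R[X] :=
  pathSeq X (κ + 1) + pathSeq X κ - C x * pathSeq X κ

theorem aeval_pathAnnihilator (κ : ℕ) (x y : R) :
    aeval (pathMatrix κ y) (pathAnnihilator κ x) = (y - x) • pathSeq (pathMatrix κ y) κ := by
  rw [pathAnnihilator, map_sub, map_add, map_mul, map_pathSeq, map_pathSeq, aeval_X, pathSeq_top,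
    aeval_C, sub_smul, Algebra.smul_def x]

theorem monic_natDegree_pathAnnihilator [Nontrivial R] (κ : ℕ) (x : R) :
    (pathAnnihilator κ x).Monic ∧ (pathAnnihilator κ x).natDegree = κ + 1 := by
  have h : pathAnnihilator κ x = pathSeq X (κ + 1) + C (1 - x) * pathSeq X κ := by
    rw [pathAnnihilator, C_sub, C_1]
    ring
  obtain ⟨h₁, h₂⟩ := monic_natDegree_pathSeq (R := R) (κ + 1)
  have hlt : (C (1 - x) * pathSeq X κ : R[X]).natDegree < (pathSeq (X : R[X]) (κ + 1)).natDegree := by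
    refine (natDegree_C_mul_le _ _).trans_lt ?_
    rw [h₂, (monic_natDegree_pathSeq κ).2]
    omega
  rw [h]
  exact ⟨h₁.add_of_left (degree_lt_degree hlt),
    by rw [natDegree_add_eq_left_of_natDegree_lt hlt, h₂]⟩

theorem aeval_prod_pathAnnihilator {ι : Type*} [DecidableEq ι] (κ : ℕ) (d : ι → R) (y : R)
    (s : Finset ι) :
    aeval (pathMatrix κ y) (∏ l ∈ s, pathAnnihilator κ (d l)) =
      (∏ l ∈ s, (y - d l)) • pathSeq (pathMatrix κ y) κ ^ s.card := by
  induction s using Finset.induction_on with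
  | empty => simp
  | insert a s ha ih =>
    rw [Finset.prod_insert ha, Finset.prod_insert ha, Finset.card_insert_of_notMem ha, map_mul, ih,
      aeval_pathAnnihilator, smul_mul_smul_comm, pow_succ']

/-- The Newton-type basis of polynomials attached to the nodes `d`. -/
noncomputable def newtonPoly {n : ℕ} (κ : ℕ) (d : Fin n → R) (q : Fin n × Fin (κ + 1)) : R[X] :=
  (∏ l ∈ Finset.Iio q.1, pathAnnihilator κ (d l)) * X ^ (q.2 : ℕ)

theorem monic_natDegree_newtonPoly [Nontrivial R] {n : ℕ} (κ : ℕ) (d : Fin n → R)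
    (q : Fin n × Fin (κ + 1)) :
    (newtonPoly κ d q).Monic ∧
      (newtonPoly κ d q).natDegree = ((finProdFinEquiv q : Fin (n * (κ + 1))) : ℕ) := by
  have h : (∏ l ∈ Finset.Iio q.1, pathAnnihilator κ (d l)).Monic :=
    monic_prod_of_monic _ _ fun l _ => (monic_natDegree_pathAnnihilator κ (d l)).1
  refine ⟨h.mul (monic_X_pow _), ?_⟩
  rw [newtonPoly, h.natDegree_mul (monic_X_pow _), natDegree_X_pow,
    natDegree_prod_of_monic _ _ fun l _ => (monic_natDegree_pathAnnihilator κ (d l)).1,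
    Finset.sum_congr rfl fun l _ => (monic_natDegree_pathAnnihilator κ (d l)).2]
  simp [finProdFinEquiv]
  ring

theorem aeval_newtonPoly_mulVec {n : ℕ} (κ : ℕ) (d : Fin n → R) (q : Fin n × Fin (κ + 1)) (y : R)
    (v : Fin (κ + 1) → R) :
    aeval (pathMatrix κ y) (newtonPoly κ d q) *ᵥ v =
      (∏ l ∈ Finset.Iio q.1, (y - d l)) •
        (pathSeq (pathMatrix κ y) κ ^ (q.1 : ℕ) *ᵥ (pathMatrix κ y ^ (q.2 : ℕ) *ᵥ v)) := by
  rw [newtonPoly, map_mul, aeval_prod_pathAnnihilator, map_pow, aeval_X, ← mulVec_mulVec,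
    smul_mulVec, Fin.card_Iio]

/-- Block `(p, q)` with `p < q` contains the factor `d p - d p = 0`, so only the diagonal blocks
count. -/
theorem det_newtonPoly {n : ℕ} (κ : ℕ) (d : Fin n → R) :
    (Matrix.of fun p q : Fin n × Fin (κ + 1) =>
      (aeval (pathMatrix κ (d p.1)) (newtonPoly κ d q) *ᵥ fun _ => 1) p.2).det =
      ∏ i : Fin n, (∏ l ∈ Finset.Iio i, (d i - d l)) ^ (κ + 1) *
        (((Equiv.Perm.sign (Fin.revPerm : Equiv.Perm (Fin (κ + 1))) : ℤ) : R) ^ (i : ℕ) *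
          d i ^ κ) := by
  rw [← det_transpose, BlockTriangular.det_fintype (b := Prod.fst)]
  · refine Finset.prod_congr rfl fun i _ => ?_
    let e : Fin (κ + 1) ≃ {a : Fin n × Fin (κ + 1) // a.1 = i} :=
      { toFun := fun s => ⟨(i, s), rfl⟩
        invFun := fun a => a.1.2
        left_inv := fun s => rfl
        right_inv := by
          rintro ⟨⟨j, s⟩, rfl⟩
          rfl }
    have hsmul : ∀ (c : R) (M : Matrix (Fin (κ + 1)) (Fin (κ + 1)) R),
        c ^ (κ + 1) * M.det = (c • M).det := by
      simp
    rw [← det_submatrix_equiv_self e, ← det_pathSeq_top κ (d i), ← det_pathMatrix_walk κ (d i),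
      ← det_pow, ← det_mul, hsmul, ← det_transpose]
    congr 1
    ext s m
    change (aeval (pathMatrix κ (d i)) (newtonPoly κ d (i, m)) *ᵥ fun _ => 1) s = _
    rw [aeval_newtonPoly_mulVec]
    rfl
  · intro q p hqp
    have hmem : p.1 ∈ Finset.Iio q.1 := Finset.mem_Iio.2 hqp
    change (aeval (pathMatrix κ (d p.1)) (newtonPoly κ d q) *ᵥ fun _ => 1) p.2 = 0
    rw [aeval_newtonPoly_mulVec, Finset.prod_eq_zero hmem (sub_self _), zero_smul, Pi.zero_apply]

/-- The walk matrix of a direct sum of `pathMatrix`es. -/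
theorem det_sum_pathMatrix_walk {n : ℕ} (κ : ℕ) (d : Fin n → R) :
    (Matrix.of fun p q : Fin n × Fin (κ + 1) =>
      (pathMatrix κ (d p.1) ^ ((finProdFinEquiv q : Fin (n * (κ + 1))) : ℕ) *ᵥ fun _ => 1) p.2).det =
      ((Equiv.Perm.sign (Fin.revPerm : Equiv.Perm (Fin (κ + 1))) : ℤ) : R) ^ (∑ i : Fin n, (i : ℕ)) *
        (∏ i, d i) ^ κ * (vandermonde d).det ^ (κ + 1) := by
  nontriviality R
  let φ : Fin (n * (κ + 1)) → R[X] →ₗ[R] R := fun r =>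
    (LinearMap.proj (finProdFinEquiv.symm r).2 ∘ₗ (mulVecBilin R R).flip (fun _ => 1)) ∘ₗ
      (aeval (pathMatrix κ (d (finProdFinEquiv.symm r).1))).toLinearMap
  have hφ : ∀ r p, φ r p = (aeval (pathMatrix κ (d (finProdFinEquiv.symm r).1)) p *ᵥ fun _ => 1)
      (finProdFinEquiv.symm r).2 := fun _ _ => rfl
  have h := det_linearMap_monic φ (fun j => newtonPoly κ d (finProdFinEquiv.symm j))
    (fun j => by rw [(monic_natDegree_newtonPoly κ d _).2, Equiv.apply_symm_apply])
    (fun j => (monic_natDegree_newtonPoly κ d _).1)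
  rw [← det_submatrix_equiv_self finProdFinEquiv,
    ← det_submatrix_equiv_self finProdFinEquiv (Matrix.of fun r j => φ r (newtonPoly κ d _))] at h
  simp only [submatrix, of_apply, hφ, Equiv.symm_apply_apply, map_pow, aeval_X] at h
  rw [h, det_newtonPoly, Finset.prod_mul_distrib, Finset.prod_mul_distrib, Finset.prod_pow,
    Finset.prod_pow, Finset.prod_pow_eq_pow_sum, det_vandermonde,
    Finset.prod_comm' (s := Finset.univ) (t := fun i => Finset.Iio i) (t' := Finset.univ)
      (s' := fun i => Finset.Ioi i) (by simp)]
  ring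

end Newton

/-! ### Signs of the reorderings -/

section Sign

/-- The sign of the permutation comparing two enumerations, by counting inversions. -/
theorem sign_trans_symm_eq_prod {α : Type*} [Fintype α] [DecidableEq α] {N : ℕ} (e f : α ≃ Fin N) :
    Equiv.Perm.sign (f.trans e.symm) =
      ∏ x : α, ∏ y : α, if e x < e y ∧ f y < f x then (-1 : ℤˣ) else 1 := by
  have h : f.trans e.symm = (e.trans (e.symm.trans f)).trans e.symm := by
    ext x
    simp
  rw [h, Equiv.Perm.sign_trans_trans_symm, Equiv.Perm.sign_eq_prod_prod_Ioi, ← e.prod_comp]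
  refine Finset.prod_congr rfl fun x _ => ?_
  have hIoi : Finset.Ioi (e x) = Finset.univ.filter fun b => e x < b := by
    ext b
    simp
  rw [hIoi, Finset.prod_filter, ← e.prod_comp]
  refine Finset.prod_congr rfl fun y _ => ?_
  simp only [Equiv.trans_apply, Equiv.symm_apply_apply]
  by_cases hxy : e x < e y
  · have hne : f x ≠ f y := fun hf => hxy.ne (by rw [f.injective hf])
    rcases lt_or_gt_of_ne hne with h | h
    · simp [hxy, h, h.not_gt]
    · simp [hxy, h, h.not_gt]
  · simp [hxy]

theorem sign_revPerm_eq_prod (k : ℕ) :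
    Equiv.Perm.sign (Fin.revPerm : Equiv.Perm (Fin k)) =
      ∏ s : Fin k, ∏ t : Fin k, if s < t then (-1 : ℤˣ) else 1 := by
  have h := sign_trans_symm_eq_prod (Equiv.refl (Fin k)) Fin.revPerm
  rw [Equiv.refl_symm, Equiv.trans_refl] at h
  simpa using h

theorem sign_revPerm (k : ℕ) :
    Equiv.Perm.sign (Fin.revPerm : Equiv.Perm (Fin k)) = (-1) ^ (∑ s ∈ Finset.range k, s) := by
  rw [sign_revPerm_eq_prod, Finset.prod_comm, ← Fin.sum_univ_eq_sum_range (fun s => s),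
    ← Finset.prod_pow_eq_pow_sum]
  refine Finset.prod_congr rfl fun t _ => ?_
  rw [Finset.prod_ite, Finset.prod_const_one, mul_one, Finset.prod_const,
    Finset.filter_gt_eq_Iio, Fin.card_Iio]

/-- The enumeration of `Fin n × Fin k` block by block, the blocks `(·, s)` in decreasing order
of `s`. -/
def revBlockOrder (n k : ℕ) : Fin n × Fin k ≃ Fin (k * n) :=
  ((Equiv.prodComm (Fin n) (Fin k)).trans (Equiv.prodCongr Fin.revPerm (Equiv.refl (Fin n)))).trans
    finProdFinEquiv

theorem finProdFinEquiv_lt_iff {m n : ℕ} (x y : Fin m × Fin n) :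
    finProdFinEquiv x < finProdFinEquiv y ↔ x.1 < y.1 ∨ x.1 = y.1 ∧ x.2 < y.2 := by
  obtain ⟨i, s⟩ := x
  obtain ⟨j, t⟩ := y
  have hs := s.2
  have ht := t.2
  simp only [finProdFinEquiv, Equiv.coe_fn_mk, Fin.lt_def, Fin.ext_iff]
  constructor
  · intro h
    by_contra hc
    rcases lt_trichotomy (i : ℕ) j with hij | hij | hij
    · exact hc (Or.inl hij)
    · rw [hij] at h
      exact hc (Or.inr ⟨hij, by omega⟩)
    · have : n * (j + 1) ≤ n * i := Nat.mul_le_mul_left n hij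
      rw [mul_add] at this
      omega
  · rintro (hij | ⟨hij, hst⟩)
    · have : n * (i + 1) ≤ n * j := Nat.mul_le_mul_left n hij
      rw [mul_add] at this
      omega
    · rw [hij]
      omega

/-- The inversions are the pairs with `x.1 ≤ y.1` and `x.2 < y.2`. Each pair `i ≤ j` of first
coordinates thus contributes one reversal sign, and each `j` has `j + 1` such `i`. -/
theorem sign_revBlockOrder (n k : ℕ) :
    Equiv.Perm.sign (((revBlockOrder n k).trans (finCongr (mul_comm k n))).trans
      finProdFinEquiv.symm) =
      Equiv.Perm.sign (Fin.revPerm : Equiv.Perm (Fin k)) ^ (∑ i : Fin n, ((i : ℕ) + 1)) := by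
  rw [sign_trans_symm_eq_prod]
  have h : ∀ x y : Fin n × Fin k, (finProdFinEquiv x < finProdFinEquiv y ∧
      ((revBlockOrder n k).trans (finCongr (mul_comm k n))) y <
        ((revBlockOrder n k).trans (finCongr (mul_comm k n))) x) ↔ x.1 ≤ y.1 ∧ x.2 < y.2 := by
    intro x y
    have h2 : ((revBlockOrder n k).trans (finCongr (mul_comm k n))) y <
        ((revBlockOrder n k).trans (finCongr (mul_comm k n))) x ↔
        finProdFinEquiv (y.2.rev, y.1) < finProdFinEquiv (x.2.rev, x.1) := Iff.rfl
    rw [h2, finProdFinEquiv_lt_iff, finProdFinEquiv_lt_iff]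
    simp only [Fin.rev_lt_rev, Fin.rev_inj]
    grind
  simp only [h]
  simp only [Fintype.prod_prod_type]
  rw [← Finset.prod_pow_eq_pow_sum, sign_revPerm_eq_prod]
  calc _ = ∏ j : Fin n, ∏ i : Fin n, ∏ s : Fin k, ∏ t : Fin k,
        (if i ≤ j ∧ s < t then (-1 : ℤˣ) else 1) := by
        rw [Finset.prod_comm]
        simp_rw [Finset.prod_comm (s := (Finset.univ : Finset (Fin k)))
          (t := (Finset.univ : Finset (Fin n)))]
        rw [Finset.prod_comm]
    _ = _ := by
        refine Finset.prod_congr rfl fun j _ => ?_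
        rw [← Fin.card_Iic, ← Finset.prod_const, ← Finset.filter_ge_eq_Iic, Finset.prod_filter]
        refine Finset.prod_congr rfl fun i _ => ?_
        by_cases hij : i ≤ j <;> simp [hij]

end Sign

/-! ### The signless Laplacian as an operator -/

theorem signlessLaplacian_mulVec {V : Type*} [Fintype V] [DecidableEq V] (G : SimpleGraph V)
    [DecidableRel G.Adj] (f : V → ℤ) (v : V) :
    (signlessLaplacian G *ᵥ f) v = ∑ w, if G.Adj v w then f v + f w else 0 := by
  rw [signlessLaplacian, add_mulVec, Pi.add_apply, SimpleGraph.adjMatrix_mulVec_apply,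
    SimpleGraph.degMatrix, mulVec_diagonal, ← Finset.sum_filter, Finset.sum_add_distrib,
    Finset.sum_const, ← SimpleGraph.neighborFinset_eq_filter, SimpleGraph.card_neighborFinset_eq_degree,
    nsmul_eq_mul]

theorem signlessLaplacian_rootedPathProduct_mulVec {V : Type*} [Fintype V] [DecidableEq V]
    (G : SimpleGraph V) [DecidableRel G.Adj] (κ : ℕ) (hk : 1 ≤ κ + 1) (g : V → ℕ → ℤ)
    (v : V) (s : Fin (κ + 1)) :
    (signlessLaplacian (rootedPathProduct G (κ + 1) hk) *ᵥ fun x => g x.1 x.2) (v, s) =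
      (if (s : ℕ) = 0 then (signlessLaplacian G *ᵥ fun w => g w 0) v else 0) +
        (if 0 < (s : ℕ) then g v (s - 1) + g v s else 0) +
        (if (s : ℕ) < κ then g v s + g v (s + 1) else 0) := by
  have hs := s.2
  rw [signlessLaplacian_mulVec]
  -- Edges of `G` at the root level and path edges are disjoint, since adjacent vertices of `G`
  -- differ.
  have hsplit : ∀ x : V × Fin (κ + 1),
      (if (rootedPathProduct G (κ + 1) hk).Adj (v, s) x then g v s + g x.1 x.2 else 0) =
      (if (s : ℕ) = 0 then (if G.Adj v x.1 then if (x.2 : ℕ) = 0 then g v 0 + g x.1 0 else 0 else 0)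
        else 0) +
      (if x.1 = v then (if 0 < (s : ℕ) then (if (x.2 : ℕ) = s - 1 then g v (s - 1) + g v s else 0)
          else 0) +
        (if (s : ℕ) < κ then (if (x.2 : ℕ) = s + 1 then g v s + g v (s + 1) else 0) else 0)
        else 0) := by
    rintro ⟨w, t⟩
    have ht := t.2
    have hvw : G.Adj v w → v ≠ w := fun h => h.ne
    simp only [rootedPathProduct_adj]
    grind
  rw [Finset.sum_congr rfl fun x _ => hsplit x, Finset.sum_add_distrib, Fintype.sum_prod_type,
    Fintype.sum_prod_type_right, add_assoc]
  congr 1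
  · split_ifs
    · rw [signlessLaplacian_mulVec]
      refine Finset.sum_congr rfl fun w _ => ?_
      split_ifs
      · rw [Fin.sum_univ_eq_sum_range (fun t => if t = 0 then g v 0 + g w 0 else 0)]
        simp
      · simp
    · simp
  · simp only [Finset.sum_ite_eq', Finset.mem_univ, if_true]
    rw [Fin.sum_univ_eq_sum_range (fun t =>
      (if 0 < (s : ℕ) then (if t = s - 1 then g v (s - 1) + g v s else 0) else 0) +
        (if (s : ℕ) < κ then (if t = s + 1 then g v s + g v (s + 1) else 0) else 0)),
      Finset.sum_add_distrib]
    congr 1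
    · split_ifs
      · rw [Finset.sum_ite_eq', if_pos (Finset.mem_range.2 (by omega))]
      · simp
    · split_ifs
      · rw [Finset.sum_ite_eq', if_pos (Finset.mem_range.2 (by omega))]
      · simp

/-! ### Reduction to path matrices in an eigenbasis -/

section Diagonalization

variable {V : Type*} [Fintype V] [DecidableEq V] (G : SimpleGraph V) [DecidableRel G.Adj]
  {R : Type*} [CommRing R] {n : ℕ} {U : Matrix V (Fin n) R} {c d : Fin n → R}

/-- The signless Laplacian acts diagonally in an eigenbasis. -/
theorem cast_signlessLaplacian_mulVec
    (hU : ∀ v i, ∑ w, (signlessLaplacian G v w : R) * U w i = U v i * d i)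
    (f : V → ℤ) (y : Fin n → R) (hf : ∀ v, (f v : R) = ∑ i, U v i * y i) (v : V) :
    ((signlessLaplacian G *ᵥ f) v : R) = ∑ i, U v i * (d i * y i) := by
  simp only [mulVec, dotProduct, Int.cast_sum, Int.cast_mul, hf, Finset.mul_sum]
  rw [Finset.sum_comm]
  refine Finset.sum_congr rfl fun i _ => ?_
  rw [← mul_assoc, ← hU, Finset.sum_mul]
  exact Finset.sum_congr rfl fun w _ => (mul_assoc _ _ _).symm

theorem cast_walk (hU : ∀ v i, ∑ w, (signlessLaplacian G v w : R) * U w i = U v i * d i)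
    (hc : ∀ v, ∑ i, U v i * c i = 1) (j : ℕ) (v : V) :
    (((signlessLaplacian G ^ j) *ᵥ fun _ => 1) v : R) = ∑ i, U v i * (c i * d i ^ j) := by
  induction j generalizing v with
  | zero => simp [hc]
  | succ j ih =>
    rw [pow_succ', ← mulVec_mulVec, cast_signlessLaplacian_mulVec G hU _ _ ih]
    exact Finset.sum_congr rfl fun i _ => by ring

/-- `Q(G)` enters only at the root, where it multiplies the `i`-th eigencomponent by `d i`; `s.rev`
puts the root at the end of the path that carries the extra diagonal entry. -/
theorem cast_walk_rootedPathProduct (κ : ℕ) (hk : 1 ≤ κ + 1)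
    (hU : ∀ v i, ∑ w, (signlessLaplacian G v w : R) * U w i = U v i * d i)
    (hc : ∀ v, ∑ i, U v i * c i = 1) (j : ℕ) (v : V) (s : Fin (κ + 1)) :
    (((signlessLaplacian (rootedPathProduct G (κ + 1) hk) ^ j) *ᵥ fun _ => 1) (v, s) : R) =
      ∑ i, U v i * (c i * (pathMatrix κ (d i) ^ j *ᵥ fun _ => 1) s.rev) := by
  induction j generalizing v s with
  | zero => simp [hc]
  | succ j ih =>
    simp only [pow_succ', ← mulVec_mulVec]
    generalize signlessLaplacian (rootedPathProduct G (κ + 1) hk) ^ j *ᵥ (fun _ => (1 : ℤ)) = f at ih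
    generalize hz : (fun i => pathMatrix κ (d i) ^ j *ᵥ (fun _ => (1 : R))) = z
    have hz' : ∀ i, pathMatrix κ (d i) ^ j *ᵥ (fun _ => (1 : R)) = z i := fun i => by rw [← hz]
    simp only [hz'] at ih ⊢
    -- Extension by zero lets the neighbours `s - 1` and `s + 1` be written in `ℕ`; the default
    -- value is never used.
    let g : V → ℕ → ℤ := fun v m => if h : m < κ + 1 then f (v, ⟨m, h⟩) else 0
    let h : Fin n → ℕ → R := fun i m => if h : m < κ + 1 then z i ⟨m, h⟩ else 0
    have hg : f = fun x => g x.1 x.2 := by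
      ext x
      simp only [g, x.2.2, dif_pos]
    have hh : ∀ i, z i = fun m : Fin (κ + 1) => h i m := by
      intro i
      ext m
      simp only [h, m.2, dif_pos]
    have hgh : ∀ v m, m ≤ κ → (g v m : R) = ∑ i, U v i * (c i * h i (κ - m)) := by
      intro v m hm
      have := ih v ⟨m, by omega⟩
      simp only [hg, hh, Fin.val_rev] at this
      rw [this]
      simp
    have hs := s.2
    rw [hg, signlessLaplacian_rootedPathProduct_mulVec]
    simp only [hh, pathMatrix_mulVec, Fin.val_rev, Nat.add_sub_add_right, Int.cast_add]
    have hroot := cast_signlessLaplacian_mulVec G hU (fun w => g w 0) (fun i => c i * h i κ)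
      (fun w => hgh w 0 (Nat.zero_le _)) v
    have hpos : (0 < κ - (s : ℕ)) = ((s : ℕ) < κ) := by
      simp
    have hlt : (κ - (s : ℕ) < κ) = (0 < (s : ℕ)) := by
      simp only [eq_iff_iff]
      omega
    simp only [hpos, hlt]
    rcases Nat.eq_zero_or_pos (s : ℕ) with h0 | h0
    · rw [if_pos h0, hroot, if_neg (by omega)]
      simp only [h0, lt_irrefl, if_false, Nat.sub_zero]
      by_cases hκ : 0 < κ
      · simp only [hκ, if_true, Int.cast_add, Int.cast_zero, add_zero]
        rw [hgh v 0 (by omega), hgh v _ (by omega), ← Finset.sum_add_distrib,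
          ← Finset.sum_add_distrib]
        refine Finset.sum_congr rfl fun i _ => ?_
        simp only [zero_add, Nat.sub_zero]
        ring
      · simp only [hκ, if_false, Int.cast_zero, add_zero, zero_add]
        exact Finset.sum_congr rfl fun i _ => by ring
    · rw [if_neg h0.ne']
      simp only [h0, if_true]
      have e1 : κ - ((s : ℕ) - 1) = κ - s + 1 := by omega
      by_cases hκ : (s : ℕ) < κ
      · simp only [hκ, if_true, Int.cast_add, Int.cast_zero, zero_add]
        rw [hgh v _ (by omega), hgh v _ (by omega), hgh v _ (by omega), ← Finset.sum_add_distrib,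
          ← Finset.sum_add_distrib, ← Finset.sum_add_distrib]
        refine Finset.sum_congr rfl fun i _ => ?_
        rw [e1, Nat.sub_add_eq]
        ring
      · simp only [hκ, if_false, Int.cast_add, Int.cast_zero, zero_add, add_zero]
        rw [hgh v _ (by omega), hgh v _ (by omega), ← Finset.sum_add_distrib]
        refine Finset.sum_congr rfl fun i _ => ?_
        rw [e1]
        ring

theorem cast_det_qWalkMatrix
    (hU : ∀ v i, ∑ w, (signlessLaplacian G v w : R) * U w i = U v i * d i)
    (hc : ∀ v, ∑ i, U v i * c i = 1) (σ : V ≃ Fin n) :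
    ((qWalkMatrix G σ).det : R) =
      (U.submatrix σ.symm id * diagonal c).det * (vandermonde d).det := by
  rw [← det_mul]
  refine (RingHom.map_det (Int.castRingHom R) _).trans ?_
  congr 1
  ext r j
  rw [mul_apply]
  simp only [mul_diagonal, submatrix_apply, vandermonde_apply, mul_assoc]
  exact cast_walk G hU hc j (σ.symm r)

theorem cast_det_qWalkMatrix_rootedPathProduct (κ : ℕ) (hk : 1 ≤ κ + 1)
    (hU : ∀ v i, ∑ w, (signlessLaplacian G v w : R) * U w i = U v i * d i)
    (hc : ∀ v, ∑ i, U v i * c i = 1) (σ : V ≃ Fin n) :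
    ((qWalkMatrix (rootedPathProduct G (κ + 1) hk) (blockOrder σ (κ + 1))).det : R) =
      ((Equiv.Perm.sign (Fin.revPerm : Equiv.Perm (Fin (κ + 1))) : ℤ) : R) ^ n *
        (∏ i, d i) ^ κ * ((qWalkMatrix G σ).det : R) ^ (κ + 1) := by
  let f := revBlockOrder n (κ + 1)
  -- The exponents of `Z` follow the lexicographic order of pairs, those of the walk matrix follow
  -- `f`; `π` converts between them.
  let π : Equiv.Perm (Fin n × Fin (κ + 1)) :=
    (f.trans (finCongr (mul_comm (κ + 1) n))).trans finProdFinEquiv.symm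
  let Z : Matrix (Fin n × Fin (κ + 1)) (Fin n × Fin (κ + 1)) R := Matrix.of fun p q =>
    (pathMatrix κ (d p.1) ^ ((finProdFinEquiv q : Fin (n * (κ + 1))) : ℕ) *ᵥ fun _ => 1) p.2
  have hf : ∀ p, (blockOrder σ (κ + 1)).symm (f p) = (σ.symm p.1, p.2.rev) := by
    intro p
    rw [Equiv.symm_apply_eq]
    simp [blockOrder, f, revBlockOrder]
    rfl
  have hπ : ∀ q, ((finProdFinEquiv (π q) : Fin (n * (κ + 1))) : ℕ) = f q := by
    intro q
    exact congrArg Fin.val (Equiv.apply_symm_apply finProdFinEquiv _)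
  have hZ : ∀ p q, Z.submatrix id π p q =
      (pathMatrix κ (d p.1) ^ (f q : ℕ) *ᵥ fun _ => 1) p.2 := by
    intro p q
    simp only [Z, submatrix_apply, of_apply, hπ, id]
  have hW : (Int.castRingHom R).mapMatrix
      ((qWalkMatrix (rootedPathProduct G (κ + 1) hk) (blockOrder σ (κ + 1))).submatrix f f) =
      kroneckerMap (fun a b => a * b) (U.submatrix σ.symm id * diagonal c) 1 * Z.submatrix id π := by
    ext p q
    have h := cast_walk_rootedPathProduct G κ hk hU hc (f q) (σ.symm p.1) p.2.rev
    rw [← hf] at h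
    refine h.trans ?_
    rw [mul_apply, Fintype.sum_prod_type]
    refine Finset.sum_congr rfl fun i _ => ?_
    rw [Finset.sum_eq_single p.2]
    · rw [hZ]
      simp [mul_assoc]
    · intro s _ hs
      simp [one_apply_ne hs.symm]
    · simp
  rw [← det_submatrix_equiv_self f]
  refine (RingHom.map_det (Int.castRingHom R) _).trans ?_
  rw [hW, det_mul, det_permute', det_kronecker, det_sum_pathMatrix_walk, sign_revBlockOrder,
    cast_det_qWalkMatrix G hU hc σ]
  simp only [det_one, one_pow, mul_one, Fintype.card_fin, Units.val_pow_eq_pow_val, Int.cast_pow]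
  have hδ : ((Equiv.Perm.sign (Fin.revPerm : Equiv.Perm (Fin (κ + 1))) : ℤ) : R) ^ 2 = 1 := by
    rw [← Int.cast_pow, ← Units.val_pow_eq_pow_val, Int.units_sq]
    simp
  generalize ((Equiv.Perm.sign (Fin.revPerm : Equiv.Perm (Fin (κ + 1))) : ℤ) : R) = δ at hδ ⊢
  -- The first power is the sign of `π`, the second comes from the diagonal blocks of the Newton
  -- form.
  have hpow : δ ^ (∑ i : Fin n, ((i : ℕ) + 1)) * δ ^ (∑ i : Fin n, (i : ℕ)) = δ ^ n := by
    rw [Finset.sum_add_distrib, pow_add, mul_right_comm, ← mul_pow, ← pow_two, hδ]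
    simp
  rw [← hpow]
  ring

end Diagonalization

/-! ### Spectral theorem and final assembly -/

theorem exists_eigenbasis {V : Type*} [Fintype V] [DecidableEq V] (G : SimpleGraph V)
    [DecidableRel G.Adj] {n : ℕ} (σ : V ≃ Fin n) :
    ∃ (U : Matrix V (Fin n) ℝ) (c d : Fin n → ℝ),
      (∀ v i, ∑ w, (signlessLaplacian G v w : ℝ) * U w i = U v i * d i) ∧
      (∀ v, ∑ i, U v i * c i = 1) ∧ ∏ i, d i = ((signlessLaplacian G).det : ℝ) := by
  let A : Matrix V V ℝ := (signlessLaplacian G).map (Int.castRingHom ℝ)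
  have hA : A.IsHermitian := by
    refine IsHermitian.ext fun v w => ?_
    simp only [A, map_apply, star_trivial]
    congr 1
    simp [signlessLaplacian, SimpleGraph.degMatrix, diagonal_apply, SimpleGraph.adj_comm, eq_comm]
    grind
  let P : Matrix V V ℝ := hA.eigenvectorUnitary
  refine ⟨P.submatrix id σ.symm, (star P *ᵥ fun _ => 1) ∘ σ.symm, hA.eigenvalues ∘ σ.symm,
    fun v i => ?_, fun v => ?_, ?_⟩
  · have h := congrFun (hA.mulVec_eigenvectorBasis (σ.symm i)) v
    rw [Pi.smul_apply, smul_eq_mul, mul_comm] at h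
    exact h
  · have h : P *ᵥ (star P *ᵥ fun _ => 1) = fun _ => 1 := by
      rw [mulVec_mulVec, show P * star P = 1 from Unitary.coe_mul_star_self _, one_mulVec]
    exact (σ.symm.sum_comp fun w => P v w * (star P *ᵥ fun _ => 1) w).trans (congrFun h v)
  · refine Eq.trans ?_ (RingHom.map_det (Int.castRingHom ℝ) (signlessLaplacian G)).symm
    exact (σ.symm.prod_comp hA.eigenvalues).trans hA.det_eq_prod_eigenvalues.symm

theorem det_qWalkMatrix_rootedPathProduct {V : Type*} [Fintype V] [DecidableEq V]
    (G : SimpleGraph V) [DecidableRel G.Adj] {n : ℕ} (σ : V ≃ Fin n) (κ : ℕ) (hk : 1 ≤ κ + 1) :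
    (qWalkMatrix (rootedPathProduct G (κ + 1) hk) (blockOrder σ (κ + 1))).det =
      (-1) ^ (n * (κ + 1) * (κ + 1 + 1) / 2 + n) *
        ((signlessLaplacian G).charpoly.coeff 0) ^ κ * (qWalkMatrix G σ).det ^ (κ + 1) := by
  obtain ⟨U, c, d, hU, hc, hd⟩ := exists_eigenbasis G σ
  have h := cast_det_qWalkMatrix_rootedPathProduct G κ hk hU hc σ
  have hcard : Fintype.card V = n := by rw [Fintype.card_congr σ, Fintype.card_fin]
  rw [hd, det_eq_sign_charpoly_coeff (signlessLaplacian G), hcard, sign_revPerm] at h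
  have h' : (qWalkMatrix (rootedPathProduct G (κ + 1) hk) (blockOrder σ (κ + 1))).det =
      ((-1) ^ (∑ s ∈ Finset.range (κ + 1), s)) ^ n *
        ((-1) ^ n * (signlessLaplacian G).charpoly.coeff 0) ^ κ *
          (qWalkMatrix G σ).det ^ (κ + 1) := by
    have : Function.Injective (Int.cast : ℤ → ℝ) := Int.cast_injective
    apply this
    rw [h]
    push_cast
    rfl
  rw [h', mul_pow, ← pow_mul, ← pow_mul, ← mul_assoc, ← pow_add]
  congr 2
  -- The stated exponent exceeds the one obtained, `n ∑ s + n κ`, by the even number `2 n`.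
  have hsum : n * (κ + 1) * (κ + 1 + 1) / 2 = n * (∑ s ∈ Finset.range (κ + 1), s + (κ + 1)) := by
    have := Finset.sum_range_id_mul_two (κ + 1)
    rw [Nat.add_sub_cancel] at this
    apply Nat.div_eq_of_eq_mul_left two_pos
    nlinarith
  rw [hsum, show n * (∑ s ∈ Finset.range (κ + 1), s + (κ + 1)) + n =
    ((∑ s ∈ Finset.range (κ + 1), s) * n + n * κ) + 2 * n by ring, pow_add _ _ (2 * n),
    pow_mul _ 2 n]
  simp

/-- A change of vertex order permutes only the rows. -/
theorem det_qWalkMatrix_eq_or {V : Type*} [Fintype V] [DecidableEq V] (G : SimpleGraph V)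
    [DecidableRel G.Adj] {N : ℕ} (σ τ : V ≃ Fin N) :
    (qWalkMatrix G τ).det = (qWalkMatrix G σ).det ∨
      (qWalkMatrix G τ).det = -(qWalkMatrix G σ).det := by
  have h : qWalkMatrix G τ = (qWalkMatrix G σ).submatrix (τ.symm.trans σ : Equiv.Perm (Fin N)) id := by
    ext r j
    simp [qWalkMatrix]
  rw [h, det_permute]
  rcases Int.units_eq_one_or (Equiv.Perm.sign (τ.symm.trans σ : Equiv.Perm (Fin N))) with h | h <;>
    simp [h]

end QWalk

theorem theorem3p2 {V : Type*} [Fintype V] [DecidableEq V] (G : SimpleGraph V)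
    [DecidableRel G.Adj] {n : ℕ} (σ : V ≃ Fin n) (k : ℕ) (hk : 1 ≤ k) (a₀ : ℤ)
    (ha₀ : a₀ = (signlessLaplacian G).charpoly.coeff 0) :
    (qWalkMatrix (rootedPathProduct G k hk) (blockOrder σ k)).det =
        (-1) ^ (n * k * (k + 1) / 2 + n) * a₀ ^ (k - 1) * (qWalkMatrix G σ).det ^ k ∧
      ∀ τ : V × Fin k ≃ Fin (k * n),
        (qWalkMatrix (rootedPathProduct G k hk) τ).det =
            a₀ ^ (k - 1) * (qWalkMatrix G σ).det ^ k ∨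
          (qWalkMatrix (rootedPathProduct G k hk) τ).det =
            -(a₀ ^ (k - 1) * (qWalkMatrix G σ).det ^ k) := by
  obtain ⟨κ, rfl⟩ : ∃ κ, k = κ + 1 := ⟨k - 1, by omega⟩
  subst ha₀
  have h := QWalk.det_qWalkMatrix_rootedPathProduct G σ κ hk
  refine ⟨h, fun τ => ?_⟩
  have hτ := QWalk.det_qWalkMatrix_eq_or (rootedPathProduct G (κ + 1) hk)
    (blockOrder σ (κ + 1)) τ
  rw [h] at hτ
  rw [Nat.add_sub_cancel]
  rcases neg_one_pow_eq_or ℤ (n * (κ + 1) * (κ + 1 + 1) / 2 + n) with hs | hs <;>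
    rw [hs] at hτ
  · simpa using hτ
  · simpa [or_comm] using hτ
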